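/- Let $k\ge 1$, let $\mathcal X$ be a finite set, let $P$ be a probability distribution on $\mathcal X$, and for $i=1,\dots,k$ let $(\varphi^x_{B^i})_{x\in\mathcal X}$ be density operators on a finite-dimensional Hilbert space $\mathcal H_{B^i}$. Put $\psi_{XB^i}=\sum_{x}P(x)\,|x\rangle\langle x|\otimes\varphi^x_{B^i}$. Logarithms are to base $2$. For positive semidefinite $\rho,\sigma$ let $F(\rho,\sigma)=\|\sqrt\rho\sqrt\sigma\|_1^2$, and define $$H_{\max}(A|B)_\rho=\max_{\sigma_B}\log F(\rho_{AB},\mathbb 1_A\otimes\sigma_B),\qquad H^{\delta}_{\max}(A|B)_\rho=\min_{\tilde\rho}H_{\max}(A|B)_{\tilde\rho},$$ where $\sigma_B$ ranges over the density operators of $B$, and $\tilde\rho$ ranges over the positive semidefinite operators of trace at most $1$ with $\sqrt{1-F(\rho,\tilde\rho)}\le\delta$. A source code with compound quantum side information, with finite alphabet $\mathcal C$, consists of one encoder $g:\mathcal X\to\mathcal C$ and, for each $i$, a decoder $h_i$, i.e. for each $c\in\mathcal C$ a POVM $\{\Lambda^{x;c}_{B^i}\}_{x\in\mathcal X}$ on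 $\mathcal H_{B^i}$. Its error probability is $p_e=\max_i\Pr[h_i(\varphi^X_{B^i},g(X))\ne X]=\max_i\sum_x P(x)\sum_{x'\neq x}\operatorname{Tr}[\Lambda^{x';g(x)}_{B^i}\varphi^x_{B^i}]$, where $X\sim P$; it is $\epsilon$-good if $p_e\le\epsilon$. A non-empty finite family $\mathcal F$ of functions $f:\mathcal X\to\{0,1\}^m$ is 2-universal if for all $x\ne x'$ the proportion of $f\in\mathcal F$ with $f(x)=f(x')$ is at most $2^{-m}$. Let $0<\epsilon\le 1$, $\epsilon_1\ge 0$ and $\epsilon_2>0$ satisfy $\epsilon_1+\frac{\epsilon_2}{k+1}=\frac{\epsilon}{k+1}$. Then the numbers $H^{\epsilon_1}_{\max}(X|B^i)_\psi$ are finite, $$m=\max_{1\le i\le k}\Big\lceil H^{\epsilon_1}_{\max}(X|B^i)_\psi-2\log\epsilon_2+2\log(k+1)\Big\rceil+3$$ is a nonnegative integer, and there is an $\epsilon$-good source code with compound quantum side information for $\psi_{XB^1},\dots,\psi_{XB^k}$ whose alphabet is $\mathcal C=\{0,1\}^m$, so that $\log|\mathcal C|=m$. Moreover, the encoder can be chosen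 as a hash function: every 2-universal family $\mathcal F$ of functions $\mathcal X\to\{0,1\}^m$ contains the encoder $g$ of an $\epsilon$-good code. -/

import Mathlib

open scoped MatrixOrder ComplexOrder Kronecker

noncomputable section

namespace CQ

/-- Normalized quantum states on the finite-dimensional Hilbert space `ℂ^n`. -/
def IsState {n : Type*} [Fintype n] (ρ : Matrix n n ℂ) : Prop :=
  ρ.PosSemidef ∧ ρ.trace = 1

/-- Subnormalized quantum states: positive semidefinite operators of trace at most one. -/
def IsSubState {n : Type*} [Fintype n] (ρ : Matrix n n ℂ) : Prop :=
  ρ.PosSemidef ∧ ρ.trace.re ≤ 1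

/-- The trace norm `‖A‖₁ = Tr √(A† A)`. -/
def traceNorm {n : Type*} [Fintype n] [DecidableEq n] (A : Matrix n n ℂ) : ℝ :=
  (CFC.sqrt (A.conjTranspose * A)).trace.re

/-- The fidelity `F(ρ, σ) = ‖√ρ √σ‖₁²` of positive semidefinite operators. -/
def fidelity {n : Type*} [Fintype n] [DecidableEq n] (ρ σ : Matrix n n ℂ) : ℝ :=
  traceNorm (CFC.sqrt ρ * CFC.sqrt σ) ^ 2

/-- The purified distance `P(ρ, σ) = √(1 - F(ρ, σ))`. -/
def purifiedDist {n : Type*} [Fintype n] [DecidableEq n] (ρ σ : Matrix n n ℂ) : ℝ :=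
  Real.sqrt (1 - fidelity ρ σ)

/-- The ball of subnormalized states at purified distance at most `ε` from `ρ`. -/
def ball {n : Type*} [Fintype n] [DecidableEq n] (ε : ℝ) (ρ : Matrix n n ℂ) :
    Set (Matrix n n ℂ) :=
  {τ | IsSubState τ ∧ purifiedDist ρ τ ≤ ε}

/-- The binary logarithm of a nonnegative number, with `log 0 = -∞`. -/
def log2 (x : ℝ) : EReal :=
  if x = 0 then ⊥ else (Real.logb 2 x : EReal)

/-- The conditional max-entropy `H_max(A|B)_ρ`, the maximum over the states `σ` of `B` of
`log F(ρ, 1 ⊗ σ)`. -/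
def Hmax {a b : Type*} [Fintype a] [DecidableEq a] [Fintype b] [DecidableEq b]
    (ρ : Matrix (a × b) (a × b) ℂ) : EReal :=
  ⨆ σ ∈ {σ : Matrix b b ℂ | IsState σ}, log2 (fidelity ρ ((1 : Matrix a a ℂ) ⊗ₖ σ))

/-- The smooth conditional max-entropy `H_max^ε(A|B)_ρ`. -/
def smoothHmax {a b : Type*} [Fintype a] [DecidableEq a] [Fintype b] [DecidableEq b]
    (ε : ℝ) (ρ : Matrix (a × b) (a × b) ℂ) : EReal :=
  ⨅ τ ∈ ball ε ρ, Hmax τ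

/-- The classical-quantum state `∑ₓ P(x) |x⟩⟨x| ⊗ φˣ`. -/
def cqState {X b : Type*} [Fintype X] [DecidableEq X]
    (P : X → ℝ) (φ : X → Matrix b b ℂ) : Matrix (X × b) (X × b) ℂ :=
  ∑ x, (P x : ℂ) • (Matrix.single x x (1 : ℂ) ⊗ₖ φ x)

/-- A measurement (POVM) on `ℂ^b` with outcomes in `X`. -/
structure Povm (X b : Type*) [Fintype X] [Fintype b] [DecidableEq b] where
  op : X → Matrix b b ℂ
  posSemidef : ∀ x, (op x).PosSemidef
  sum_eq_one : ∑ x, op x = 1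

/-- The probability of the outcome `x` when the state `ρ` is measured. -/
def Povm.prob {X b : Type*} [Fintype X] [Fintype b] [DecidableEq b]
    (M : Povm X b) (ρ : Matrix b b ℂ) (x : X) : ℝ :=
  (M.op x * ρ).trace.re

/-- A source code with compound quantum side information: one encoder of the source alphabet `X`
into `C`, and for each `i` a decoder, which on the codeword `c` measures the system `B i`. -/
structure SourceCode {k : ℕ} (X C : Type*) (B : Fin k → Type*)
    [Fintype X] [∀ i, Fintype (B i)] [∀ i, DecidableEq (B i)] where
  enc : X → C
  dec : ∀ i, C → Povm X (B i)

/-- The probability that decoder `i` outputs something else than the source symbol. -/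
def SourceCode.errorAt {k : ℕ} {X C : Type*} {B : Fin k → Type*}
    [Fintype X] [DecidableEq X] [∀ i, Fintype (B i)] [∀ i, DecidableEq (B i)]
    (S : SourceCode X C B) (P : X → ℝ) (φ : ∀ i, X → Matrix (B i) (B i) ℂ) (i : Fin k) : ℝ :=
  ∑ x, P x * ∑ x' ∈ Finset.univ.filter (fun x' => x' ≠ x),
    (S.dec i (S.enc x)).prob (φ i x) x'

/-- The error probability `p_e`, the maximum of the error probabilities of the `k` decoders. -/
def SourceCode.error {k : ℕ} [NeZero k] {X C : Type*} {B : Fin k → Type*}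
    [Fintype X] [DecidableEq X] [∀ i, Fintype (B i)] [∀ i, DecidableEq (B i)]
    (S : SourceCode X C B) (P : X → ℝ) (φ : ∀ i, X → Matrix (B i) (B i) ℂ) : ℝ :=
  Finset.univ.sup' Finset.univ_nonempty (fun i => S.errorAt P φ i)

/-- A code is `ε`-good if its error probability is at most `ε`. -/
def SourceCode.IsGood {k : ℕ} [NeZero k] {X C : Type*} {B : Fin k → Type*}
    [Fintype X] [DecidableEq X] [∀ i, Fintype (B i)] [∀ i, DecidableEq (B i)]
    (S : SourceCode X C B) (P : X → ℝ) (φ : ∀ i, X → Matrix (B i) (B i) ℂ) (ε : ℝ) : Prop :=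
  S.error P φ ≤ ε

/-- A (nonempty, finite) family of hash functions `X → {0,1}^r` is 2-universal if any two distinct
points collide with probability at most `2^(-r)` under a uniformly chosen member. -/
def IsTwoUniversal {X : Type*} [Fintype X] [DecidableEq X] {r : ℕ}
    (F : Finset (X → (Fin r → Bool))) : Prop :=
  F.Nonempty ∧ ∀ x x' : X, x ≠ x' →
    ((F.filter (fun f => f x = f x')).card : ℝ) / (F.card : ℝ) ≤ ((2 : ℝ) ^ r)⁻¹

end CQ

end

/-! Random binning with a square-root decoder. Decoder `i` receives the bin `c` of `x` and measures
with the tests `S x'`, `x'` in bin `c`, normalized by the inverse square root of their sum. The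
Hayashi-Nagaoka inequality bounds the error by `2 Tr (1 - S x) ρ x` plus `4 Tr S x' ρ x` summed over
the colliding `x'`. Averaging over a 2-universal family puts a factor `1/N`, `N = 2^m`, on the
second sum, and there `∑ ρ x` may be replaced by a state `σ` above it. What remains is twice a sum
of binary tests of `ρ x` against `(2/N) σ`. The Powers-Størmer inequality (`exists_test_le`) gives
tests with total at most `√(2/N) ∑ Tr √(ρ x) √σ`, hence an average error `√(8 K / N)`, where `K`
bounds the fidelities in `H_max`. The `8 = 2^3` is the `+3` in the rate.

Smoothing: a nearby `τ` need not be classical on `X`. With `U` attaining the trace norm in the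
fidelity, the diagonal blocks `T x` of `√τ U` yield `ρ x = T x (T x)ᴴ` (`exists_classical_blocks`).
They keep the overlap with `ψ` and do not increase the relevant fidelities; exchanging `ψ` for `ρ`
costs `δ` in error probability (`sum_re_trace_test_le`).

One encoder serves all decoders: some hash function has its sum of `k` errors at most the average of
that sum, and the sum dominates the maximum. -/

namespace CQ

open Matrix
open scoped Matrix.Norms.L2Operator

set_option linter.unusedSectionVars false

/-! ### Trace inequalities, trace norm and operator inequalities -/

section Basic

variable {n : Type*} [Fintype n]

lemma re_trace_add (A B : Matrix n n ℂ) : (A + B).trace.re = A.trace.re + B.trace.re := by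
  simp

lemma re_trace_sub (A B : Matrix n n ℂ) : (A - B).trace.re = A.trace.re - B.trace.re := by
  simp

lemma re_trace_sum {ι : Type*} (s : Finset ι) (A : ι → Matrix n n ℂ) :
    (∑ i ∈ s, A i).trace.re = ∑ i ∈ s, (A i).trace.re := by
  simp [Matrix.trace_sum]

lemma re_trace_smul (r : ℝ) (A : Matrix n n ℂ) : (r • A).trace.re = r * A.trace.re := by
  simp

lemma re_trace_conjTranspose (A : Matrix n n ℂ) : Aᴴ.trace.re = A.trace.re := by
  simp [Matrix.trace_conjTranspose]

lemma re_trace_nonneg {A : Matrix n n ℂ} (hA : 0 ≤ A) : 0 ≤ A.trace.re :=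
  (Complex.nonneg_iff.1 (Matrix.nonneg_iff_posSemidef.1 hA).trace_nonneg).1

lemma re_trace_mono {A B : Matrix n n ℂ} (h : A ≤ B) : A.trace.re ≤ B.trace.re := by
  have := re_trace_nonneg (sub_nonneg.2 h)
  rw [re_trace_sub] at this
  linarith

lemma conjTranspose_mul_mul_nonneg {m : Type*} [Fintype m] {A : Matrix n n ℂ} (hA : 0 ≤ A)
    (B : Matrix n m ℂ) : 0 ≤ Bᴴ * A * B :=
  Matrix.nonneg_iff_posSemidef.2
    ((Matrix.nonneg_iff_posSemidef.1 hA).conjTranspose_mul_mul_same B)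

lemma conjTranspose_mul_self_nonneg (A : Matrix n n ℂ) : 0 ≤ Aᴴ * A :=
  Matrix.nonneg_iff_posSemidef.2 (Matrix.posSemidef_conjTranspose_mul_self A)

lemma conjTranspose_eq_of_nonneg {A : Matrix n n ℂ} (hA : 0 ≤ A) : Aᴴ = A :=
  (Matrix.nonneg_iff_posSemidef.1 hA).isHermitian

variable [DecidableEq n]

lemma sqrt_conjTranspose (A : Matrix n n ℂ) : (CFC.sqrt A)ᴴ = CFC.sqrt A :=
  conjTranspose_eq_of_nonneg (CFC.sqrt_nonneg A)

lemma re_trace_mul_nonneg {A B : Matrix n n ℂ} (hA : 0 ≤ A) (hB : 0 ≤ B) :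
    0 ≤ (A * B).trace.re := by
  have h := re_trace_nonneg (conjTranspose_mul_mul_nonneg hB (CFC.sqrt A))
  rwa [sqrt_conjTranspose, Matrix.trace_mul_comm, ← mul_assoc,
    CFC.sqrt_mul_sqrt_self A hA] at h

lemma re_trace_mul_mono_left {A B C : Matrix n n ℂ} (h : A ≤ B) (hC : 0 ≤ C) :
    (A * C).trace.re ≤ (B * C).trace.re := by
  have := re_trace_mul_nonneg (sub_nonneg.2 h) hC
  rw [sub_mul, re_trace_sub] at this
  linarith

lemma re_trace_mul_mono_right {A B C : Matrix n n ℂ} (h : A ≤ B) (hC : 0 ≤ C) :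
    (C * A).trace.re ≤ (C * B).trace.re := by
  rw [Matrix.trace_mul_comm C, Matrix.trace_mul_comm C]
  exact re_trace_mul_mono_left h hC

lemma conjTranspose_mul_self_le_one {U : Matrix n n ℂ} (hU : ‖U‖ ≤ 1) : Uᴴ * U ≤ 1 := by
  refine (CStarAlgebra.norm_le_one_iff_of_nonneg _ (conjTranspose_mul_self_nonneg U)).1 ?_
  rw [← star_eq_conjTranspose, CStarRing.norm_star_mul_self]
  exact mul_le_one₀ hU (norm_nonneg _) hU

lemma norm_le_one_of_conjTranspose_mul_self {U : Matrix n n ℂ} (hU : Uᴴ * U ≤ 1) : ‖U‖ ≤ 1 := by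
  have h := (CStarAlgebra.norm_le_one_iff_of_nonneg _ (conjTranspose_mul_self_nonneg U)).2 hU
  rw [← star_eq_conjTranspose, CStarRing.norm_star_mul_self] at h
  nlinarith [norm_nonneg U]

lemma norm_conjTranspose_le_one {U : Matrix n n ℂ} (hU : ‖U‖ ≤ 1) : ‖Uᴴ‖ ≤ 1 := by
  rwa [← star_eq_conjTranspose, norm_star]

lemma mul_conjTranspose_le_one {U : Matrix n n ℂ} (hU : ‖U‖ ≤ 1) : U * Uᴴ ≤ 1 := by
  simpa using conjTranspose_mul_self_le_one (norm_conjTranspose_le_one hU)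

lemma norm_mul_le_one {U V : Matrix n n ℂ} (hU : ‖U‖ ≤ 1) (hV : ‖V‖ ≤ 1) : ‖U * V‖ ≤ 1 :=
  (norm_mul_le _ _).trans (mul_le_one₀ hU (norm_nonneg _) hV)

lemma le_one_of_isIdempotent {S : Matrix n n ℂ} (hS : Sᴴ = S) (h : S * S = S) : S ≤ 1 := by
  have := conjTranspose_mul_self_nonneg (1 - S)
  rw [conjTranspose_sub, conjTranspose_one, hS] at this
  have e : (1 - S) * (1 - S) = 1 - S := by
    rw [sub_mul, mul_sub, mul_sub, h]; simp
  rw [e] at this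
  exact sub_nonneg.1 this

lemma nonneg_of_isIdempotent {S : Matrix n n ℂ} (hS : Sᴴ = S) (h : S * S = S) : 0 ≤ S := by
  simpa [hS, h] using conjTranspose_mul_self_nonneg S

/-- Expand `0 ≤ Tr (1 - C)ᴴ (1 - C) A` and use `Cᴴ C ≤ 1`. -/
lemma re_trace_contraction_mul_le {C A : Matrix n n ℂ} (hC : ‖C‖ ≤ 1) (hA : 0 ≤ A) :
    (C * A).trace.re ≤ A.trace.re := by
  have h1 := re_trace_mul_nonneg (conjTranspose_mul_self_nonneg (1 - C)) hA
  have h2 := re_trace_mul_mono_left (conjTranspose_mul_self_le_one hC) hA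
  have h3 : (Cᴴ * A).trace.re = (C * A).trace.re := by
    rw [← re_trace_conjTranspose, conjTranspose_mul, conjTranspose_conjTranspose,
      conjTranspose_eq_of_nonneg hA, Matrix.trace_mul_comm]
  have e : (1 - C)ᴴ * (1 - C) * A = A - C * A - Cᴴ * A + Cᴴ * C * A := by
    rw [conjTranspose_sub, conjTranspose_one]; noncomm_ring
  rw [e, re_trace_add, re_trace_sub, re_trace_sub, h3] at h1
  rw [one_mul] at h2
  linarith

/-- The inverse square root of a positive semidefinite matrix on its support, together with the
projection onto the support. -/
lemma exists_pinv_sqrt (H : Matrix n n ℂ) :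
    ∃ R S : Matrix n n ℂ, Rᴴ = R ∧ Sᴴ = S ∧ S * S = S ∧ R * CFC.sqrt H = S ∧
      CFC.sqrt H * R = S ∧ S * CFC.sqrt H = CFC.sqrt H ∧ R * S = R := by
  set K := CFC.sqrt H
  have hK : IsSelfAdjoint K := (CFC.sqrt_nonneg H).isSelfAdjoint
  have hf : ∀ f : ℝ → ℝ, ContinuousOn f (spectrum ℝ K) := fun f =>
    (Matrix.finite_real_spectrum).continuousOn f
  have hid : cfc (fun x : ℝ => x) K = K := cfc_id' ℝ K
  -- Since `0⁻¹ = 0`, the first function gives the pseudo-inverse, and `x⁻¹ * x` is the indicator of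
  -- `x ≠ 0`, giving the support projection.
  refine ⟨cfc (fun x : ℝ => x⁻¹) K, cfc (fun x : ℝ => x⁻¹ * x) K,
    (cfc_predicate _ K : IsSelfAdjoint _), (cfc_predicate _ K : IsSelfAdjoint _), ?_, ?_, ?_, ?_, ?_⟩
  · rw [← cfc_mul _ _ K (hf _) (hf _)]
    congr 1; ext x; by_cases hx : x = 0 <;> simp [hx]
  · nth_rw 2 [← hid]
    rw [← cfc_mul _ _ K (hf _) (hf _)]
  · nth_rw 1 [← hid]
    rw [← cfc_mul _ _ K (hf _) (hf _)]
    congr 1; ext x; ring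
  · nth_rw 2 [← hid]
    rw [← cfc_mul _ _ K (hf _) (hf _)]
    conv_rhs => rw [← hid]
    congr 1; ext x; by_cases hx : x = 0 <;> simp [hx]
  · rw [← cfc_mul _ _ K (hf _) (hf _)]
    congr 1; ext x; by_cases hx : x = 0 <;> simp [hx]

/-- The spectral projection of a Hermitian matrix onto its positive part. -/
lemma exists_pos_projection {D : Matrix n n ℂ} (hD : Dᴴ = D) :
    ∃ S : Matrix n n ℂ, Sᴴ = S ∧ S * S = S ∧ 0 ≤ S * D ∧ 0 ≤ -D * (1 - S) := by
  have hD' : IsSelfAdjoint D := hD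
  have hf : ∀ f : ℝ → ℝ, ContinuousOn f (spectrum ℝ D) := fun f =>
    (Matrix.finite_real_spectrum).continuousOn f
  have hid : cfc (fun x : ℝ => x) D = D := cfc_id' ℝ D
  set f : ℝ → ℝ := fun x => if 0 < x then 1 else 0
  refine ⟨cfc f D, (cfc_predicate _ D : IsSelfAdjoint _), ?_, ?_, ?_⟩
  · rw [← cfc_mul _ _ D (hf _) (hf _)]
    congr 1; ext x; by_cases hx : 0 < x <;> simp [f, hx]
  · have e : cfc f D * D = cfc (fun x => f x * x) D := by
      rw [cfc_mul _ _ D (hf _) (hf _), hid]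
    rw [e]
    refine cfc_nonneg fun x _ => ?_
    by_cases hx : 0 < x
    · simp [f, hx, hx.le]
    · simp [f, hx]
  · have e : -D * (1 - cfc f D) = cfc (fun x => x * f x - x) D := by
      rw [cfc_sub _ _ D (hf _) (hf _), cfc_mul _ _ D (hf _) (hf _), hid]; noncomm_ring
    rw [e]
    refine cfc_nonneg fun x _ => ?_
    by_cases hx : 0 < x
    · simp [f, hx]
    · have hx' := not_lt.1 hx
      simp [f, hx, hx']

/-- Polar decomposition. -/
lemma exists_polar (A : Matrix n n ℂ) :
    ∃ U : Matrix n n ℂ, ‖U‖ ≤ 1 ∧ U * A = CFC.sqrt (Aᴴ * A) ∧ Uᴴ * CFC.sqrt (Aᴴ * A) = A := by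
  have hH := conjTranspose_mul_self_nonneg A
  obtain ⟨R, S, hR, hS, hSS, hRK, hKR, hSK, hRS⟩ := exists_pinv_sqrt (Aᴴ * A)
  have hKK := CFC.sqrt_mul_sqrt_self (Aᴴ * A) hH
  set K := CFC.sqrt (Aᴴ * A)
  refine ⟨R * Aᴴ, ?_, ?_, ?_⟩
  · have h : ‖(R * Aᴴ)ᴴ‖ ≤ 1 := by
      refine norm_le_one_of_conjTranspose_mul_self ?_
      have e : (R * Aᴴ)ᴴᴴ * (R * Aᴴ)ᴴ = S := by
        rw [conjTranspose_conjTranspose, conjTranspose_mul, conjTranspose_conjTranspose, hR]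
        calc R * Aᴴ * (A * R) = R * (Aᴴ * A) * R := by noncomm_ring
          _ = (R * K) * (K * R) := by rw [← hKK]; noncomm_ring
          _ = S := by rw [hRK, hKR, hSS]
      rw [e]
      exact le_one_of_isIdempotent hS hSS
    simpa using norm_conjTranspose_le_one h
  · rw [mul_assoc, ← hKK, ← mul_assoc, hRK, hSK]
  · have hSH : (Aᴴ * A) * S = Aᴴ * A := by
      have hKS : K * S = K := by
        have := congrArg conjTranspose hSK
        rwa [conjTranspose_mul, hS, sqrt_conjTranspose] at this
      rw [← hKK, mul_assoc, hKS]
    -- `A` vanishes wherever `√(Aᴴ A)` does, so `A S = A`.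
    have h0 : (A - A * S)ᴴ * (A - A * S) = 0 := by
      rw [conjTranspose_sub, conjTranspose_mul, hS]
      calc (Aᴴ - S * Aᴴ) * (A - A * S) = (1 - S) * (Aᴴ * A - (Aᴴ * A) * S) := by noncomm_ring
        _ = 0 := by rw [hSH]; simp
    have h1 := Matrix.conjTranspose_mul_self_eq_zero.1 h0
    rw [conjTranspose_mul, conjTranspose_conjTranspose, hR, mul_assoc, hRK]
    exact (sub_eq_zero.1 h1).symm

/-- Half of the duality between trace norm and contractions: with `A = Vᴴ |A|`, the product `U Vᴴ`
is again a contraction. The next lemma shows that the bound is attained. -/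
lemma re_trace_mul_le_traceNorm {U : Matrix n n ℂ} (hU : ‖U‖ ≤ 1) (A : Matrix n n ℂ) :
    (U * A).trace.re ≤ traceNorm A := by
  obtain ⟨V, hV, -, h⟩ := exists_polar A
  unfold traceNorm
  nth_rw 1 [← h]
  rw [← mul_assoc]
  exact re_trace_contraction_mul_le (norm_mul_le_one hU (norm_conjTranspose_le_one hV))
    (CFC.sqrt_nonneg _)

lemma exists_re_trace_mul_eq_traceNorm (A : Matrix n n ℂ) :
    ∃ U : Matrix n n ℂ, ‖U‖ ≤ 1 ∧ (U * A).trace.re = traceNorm A := by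
  obtain ⟨V, hV, h, -⟩ := exists_polar A
  exact ⟨V, hV, by rw [h]; rfl⟩

lemma traceNorm_nonneg (A : Matrix n n ℂ) : 0 ≤ traceNorm A :=
  re_trace_nonneg (CFC.sqrt_nonneg _)

lemma traceNorm_conjTranspose_le (A : Matrix n n ℂ) : traceNorm A ≤ traceNorm Aᴴ := by
  obtain ⟨U, hU, h⟩ := exists_re_trace_mul_eq_traceNorm A
  rw [← h, ← re_trace_conjTranspose, conjTranspose_mul, Matrix.trace_mul_comm]
  exact re_trace_mul_le_traceNorm (norm_conjTranspose_le_one hU) _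

lemma traceNorm_conjTranspose (A : Matrix n n ℂ) : traceNorm Aᴴ = traceNorm A :=
  le_antisymm (by simpa using traceNorm_conjTranspose_le Aᴴ) (traceNorm_conjTranspose_le A)

/-- A positive semidefinite `T * Tᴴ` has a square root of the form `T * V`, `V` a contraction. -/
lemma exists_sqrt_mul_conjTranspose (T : Matrix n n ℂ) :
    ∃ V : Matrix n n ℂ, ‖V‖ ≤ 1 ∧ CFC.sqrt (T * Tᴴ) = T * V := by
  obtain ⟨V, hV, h, -⟩ := exists_polar Tᴴ
  rw [conjTranspose_conjTranspose] at h
  refine ⟨Vᴴ, norm_conjTranspose_le_one hV, ?_⟩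
  rw [← sqrt_conjTranspose, ← h, conjTranspose_mul, conjTranspose_conjTranspose]

/-- The Cauchy-Schwarz inequality for the Hilbert-Schmidt inner product. -/
lemma sum_re_trace_le {ι : Type*} (s : Finset ι) (A C : ι → Matrix n n ℂ) :
    ∑ i ∈ s, ((A i)ᴴ * C i).trace.re ≤
      √(∑ i ∈ s, ((A i)ᴴ * A i).trace.re) * √(∑ i ∈ s, ((C i)ᴴ * C i).trace.re) := by
  set a := ∑ i ∈ s, ((A i)ᴴ * A i).trace.re
  set b := ∑ i ∈ s, ((C i)ᴴ * C i).trace.re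
  set c := ∑ i ∈ s, ((A i)ᴴ * C i).trace.re
  have ha : 0 ≤ a := Finset.sum_nonneg fun i _ => re_trace_nonneg (conjTranspose_mul_self_nonneg _)
  -- The quadratic is the sum of the squared Hilbert-Schmidt norms of `A i - t C i`; its
  -- discriminant is nonpositive.
  have h : ∀ t : ℝ, 0 ≤ b * (t * t) + (-2 * c) * t + a := by
    intro t
    have h1 : ∀ i, ((A i - t • C i)ᴴ * (A i - t • C i)).trace.re =
        ((C i)ᴴ * C i).trace.re * (t * t) + (-2 * ((A i)ᴴ * C i).trace.re) * t
          + ((A i)ᴴ * A i).trace.re := by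
      intro i
      have h3 : ((C i)ᴴ * A i).trace.re = ((A i)ᴴ * C i).trace.re := by
        rw [← re_trace_conjTranspose, conjTranspose_mul, conjTranspose_conjTranspose]
      rw [conjTranspose_sub, conjTranspose_smul, star_trivial, sub_mul, mul_sub, mul_sub,
        smul_mul_assoc, smul_mul_assoc, mul_smul_comm, mul_smul_comm, re_trace_sub, re_trace_sub,
        re_trace_sub, re_trace_smul, re_trace_smul, re_trace_smul, re_trace_smul, h3]
      ring
    have h2 : 0 ≤ ∑ i ∈ s, ((A i - t • C i)ᴴ * (A i - t • C i)).trace.re :=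
      Finset.sum_nonneg fun i _ => re_trace_nonneg (conjTranspose_mul_self_nonneg _)
    rw [Finset.sum_congr rfl fun i _ => h1 i, Finset.sum_add_distrib, Finset.sum_add_distrib,
      ← Finset.sum_mul, ← Finset.sum_mul, ← Finset.mul_sum] at h2
    exact h2
  have hd := discrim_le_zero h
  rw [discrim] at hd
  rw [← Real.sqrt_mul ha]
  refine Real.le_sqrt_of_sq_le ?_
  nlinarith

/-- The Powers-Størmer inequality in the form of a test between `A` and `C`. -/
lemma exists_test_le {A C : Matrix n n ℂ} (hA : 0 ≤ A) (hC : 0 ≤ C) :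
    ∃ S : Matrix n n ℂ, 0 ≤ S ∧ S ≤ 1 ∧
      ((1 - S) * A).trace.re + (S * C).trace.re ≤ (CFC.sqrt A * CFC.sqrt C).trace.re := by
  have ha := CFC.sqrt_mul_sqrt_self A hA
  have hc := CFC.sqrt_mul_sqrt_self C hC
  have ha0 := CFC.sqrt_nonneg A
  have hc0 := CFC.sqrt_nonneg C
  have hD : (CFC.sqrt A - CFC.sqrt C)ᴴ = CFC.sqrt A - CFC.sqrt C := by
    rw [conjTranspose_sub, sqrt_conjTranspose, sqrt_conjTranspose]
  set a := CFC.sqrt A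
  set c := CFC.sqrt C
  -- The test projects onto the positive part of `√A - √C`, not of `A - C`; the gap is then a sum of
  -- two traces of products of positive operators.
  obtain ⟨S, hS, hSS, h1, h2⟩ := exists_pos_projection hD
  refine ⟨S, nonneg_of_isIdempotent hS hSS, le_one_of_isIdempotent hS hSS, ?_⟩
  have h3 := re_trace_mul_nonneg h1 hc0
  have h4 := re_trace_mul_nonneg h2 ha0
  have e4 : (-(a - c) * (1 - S) * a).trace = ((1 - S) * a * (c - a)).trace := by
    rw [mul_assoc, Matrix.trace_mul_comm, neg_sub]
  rw [e4] at h4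
  have e : a * c - (1 - S) * A - S * C = S * (a - c) * c + (1 - S) * a * (c - a) := by
    rw [← ha, ← hc]; noncomm_ring
  have h5 := congrArg (fun M : Matrix n n ℂ => M.trace.re) e
  simp only [re_trace_add, re_trace_sub] at h5
  linarith

/-- Here `R` stands for the inverse square root of `S + T` on its support, `Q` for the support
projection and `K` for the square root. Each summand on the right is then positive. -/
lemma hayashi_nagaoka_identity {A : Type*} [Ring A] {S T R Q K : A} (h1 : R * (S + T) * R = Q)
    (h2 : R * (S + T) = K) (h3 : (S + T) * R = K) :
    2 • (1 - S) + 4 • T - (1 - R * S * R) =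
      (R - 1 - 1) * T * (R - 1 - 1) + (1 - Q) + 4 • (K - S) + 2 • ((R - 1) * S * (R - 1)) := by
  have e : 2 • (1 - S) + 4 • T - (1 - R * S * R) =
      (R - 1 - 1) * T * (R - 1 - 1) + (1 - R * (S + T) * R)
        + 4 • (0 - S) + 2 • ((R - 1) * S * (R - 1)) + 2 • (R * (S + T)) + 2 • ((S + T) * R) := by
    noncomm_ring
  rw [e, h1, h2, h3]
  noncomm_ring

/-- The Hayashi-Nagaoka inequality for a given inverse square root of `S + T` on its support. -/
lemma hayashi_nagaoka {S T R Q : Matrix n n ℂ} (hS : 0 ≤ S) (hS1 : S ≤ 1) (hT : 0 ≤ T)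
    (hR : Rᴴ = R) (hQ : Qᴴ = Q) (hQQ : Q * Q = Q) (h1 : R * CFC.sqrt (S + T) = Q)
    (h2 : CFC.sqrt (S + T) * R = Q) (h3 : Q * CFC.sqrt (S + T) = CFC.sqrt (S + T)) :
    1 - R * S * R ≤ 2 • (1 - S) + 4 • T := by
  have hH : 0 ≤ S + T := add_nonneg hS hT
  have hKK := CFC.sqrt_mul_sqrt_self (S + T) hH
  -- `S ≤ √S` because `S ≤ 1`, and the square root is operator monotone.
  have hSK : S ≤ CFC.sqrt (S + T) := by
    have hSS : S ≤ CFC.sqrt S := by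
      have hs := CFC.sqrt_mul_sqrt_self S hS
      have hs1 : CFC.sqrt S ≤ 1 := by
        have := CFC.sqrt_le_sqrt S 1 hS1
        rwa [CFC.sqrt_one] at this
      have h0 := CFC.sqrt_nonneg S
      set s := CFC.sqrt S
      have hss : 0 ≤ s - S := by
        obtain ⟨r, hr0, hr⟩ : ∃ r : Matrix n n ℂ, 0 ≤ r ∧ r * r = s :=
          ⟨CFC.sqrt s, CFC.sqrt_nonneg s, CFC.sqrt_mul_sqrt_self s h0⟩
        have := conjTranspose_mul_mul_nonneg (sub_nonneg.2 hs1) r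
        rw [conjTranspose_eq_of_nonneg hr0] at this
        have e : r * (1 - s) * r = s - S := by
          rw [← hs, ← hr]; noncomm_ring
        rwa [e] at this
      exact sub_nonneg.1 hss
    exact hSS.trans (CFC.sqrt_le_sqrt _ _ (le_add_of_nonneg_right hT))
  set K := CFC.sqrt (S + T)
  have hRHR : R * (S + T) * R = Q := by
    rw [← hKK]
    calc R * (K * K) * R = (R * K) * (K * R) := by noncomm_ring
      _ = Q := by rw [h1, h2, hQQ]
  have hRH : R * (S + T) = K := by rw [← hKK, ← mul_assoc, h1, h3]
  have hHR : (S + T) * R = K := by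
    have := congrArg conjTranspose hRH
    rwa [conjTranspose_mul, hR, conjTranspose_eq_of_nonneg hH,
      sqrt_conjTranspose] at this
  have p1 := conjTranspose_mul_mul_nonneg hT (R - 1 - 1)
  have p2 := conjTranspose_mul_mul_nonneg hS (R - 1)
  have p3 := sub_nonneg.2 (le_one_of_isIdempotent hQ hQQ)
  have p4 := sub_nonneg.2 hSK
  rw [conjTranspose_sub, conjTranspose_sub, hR, conjTranspose_one] at p1
  rw [conjTranspose_sub, hR, conjTranspose_one] at p2
  refine sub_nonneg.1 ?_
  rw [hayashi_nagaoka_identity hRHR hRH hHR]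
  exact add_nonneg (add_nonneg (add_nonneg p1 p3) (nsmul_nonneg p4 4)) (nsmul_nonneg p2 2)

end Basic

/-! ### Block-diagonal operators and smoothing by classical-quantum states -/

section Blocks

variable {X b : Type*} [Fintype X] [DecidableEq X] [Fintype b] [DecidableEq b]

/-- The block-diagonal matrix `∑ₓ |x⟩⟨x| ⊗ G x`. -/
def blockDiag (G : X → Matrix b b ℂ) : Matrix (X × b) (X × b) ℂ :=
  Matrix.of fun p q => if p.1 = q.1 then G p.1 p.2 q.2 else 0

/-- The diagonal block `⟨x| T |x⟩`. -/
def diagBlock (T : Matrix (X × b) (X × b) ℂ) (x : X) : Matrix b b ℂ :=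
  Matrix.of fun i j => T (x, i) (x, j)

lemma blockDiag_mul (G H : X → Matrix b b ℂ) :
    blockDiag G * blockDiag H = blockDiag fun x => G x * H x := by
  ext ⟨x, i⟩ ⟨y, j⟩
  by_cases h : x = y
  · subst h
    simp [blockDiag, Matrix.mul_apply, Fintype.sum_prod_type]
  · simp [blockDiag, Matrix.mul_apply, Fintype.sum_prod_type, h]

lemma blockDiag_conjTranspose (G : X → Matrix b b ℂ) :
    (blockDiag G)ᴴ = blockDiag fun x => (G x)ᴴ := by
  ext ⟨x, i⟩ ⟨y, j⟩
  by_cases h : x = y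
  · subst h
    simp [blockDiag]
  · simp [blockDiag, h, Ne.symm h]

lemma blockDiag_sub (G H : X → Matrix b b ℂ) :
    blockDiag G - blockDiag H = blockDiag fun x => G x - H x := by
  ext ⟨x, i⟩ ⟨y, j⟩
  by_cases h : x = y <;> simp [blockDiag, h]

lemma one_kronecker_eq_blockDiag (σ : Matrix b b ℂ) :
    (1 : Matrix X X ℂ) ⊗ₖ σ = blockDiag fun _ => σ := by
  ext ⟨x, i⟩ ⟨y, j⟩
  by_cases h : x = y <;> simp [blockDiag, h]

lemma blockDiag_one : blockDiag (fun _ : X => (1 : Matrix b b ℂ)) = 1 := by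
  rw [← one_kronecker_eq_blockDiag, Matrix.one_kronecker_one]

lemma cqState_eq_blockDiag (P : X → ℝ) (φ : X → Matrix b b ℂ) :
    cqState P φ = blockDiag fun x => P x • φ x := by
  ext ⟨x, i⟩ ⟨y, j⟩
  by_cases h : x = y
  · subst h
    simp [cqState, blockDiag, Matrix.sum_apply, Matrix.single_apply]
  · have : ∀ z, ¬ (z = x ∧ z = y) := fun z hz => h (hz.1.symm.trans hz.2)
    simp [cqState, blockDiag, Matrix.sum_apply, h, this]

lemma trace_blockDiag_mul (G : X → Matrix b b ℂ) (T : Matrix (X × b) (X × b) ℂ) :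
    (blockDiag G * T).trace = ∑ x, (G x * diagBlock T x).trace := by
  simp [blockDiag, diagBlock, Matrix.trace, Matrix.mul_apply, Fintype.sum_prod_type]

lemma diagBlock_blockDiag (G : X → Matrix b b ℂ) (x : X) : diagBlock (blockDiag G) x = G x := by
  ext i j
  simp [blockDiag, diagBlock]

lemma trace_blockDiag (G : X → Matrix b b ℂ) : (blockDiag G).trace = ∑ x, (G x).trace := by
  simp [blockDiag, Matrix.trace, Fintype.sum_prod_type]

lemma blockDiag_nonneg {G : X → Matrix b b ℂ} (hG : ∀ x, 0 ≤ G x) : 0 ≤ blockDiag G := by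
  have h := conjTranspose_mul_self_nonneg (blockDiag fun x => CFC.sqrt (G x))
  rw [blockDiag_conjTranspose, blockDiag_mul] at h
  simpa only [sqrt_conjTranspose, CFC.sqrt_mul_sqrt_self _ (hG _)] using h

lemma blockDiag_mono {G H : X → Matrix b b ℂ} (h : ∀ x, G x ≤ H x) :
    blockDiag G ≤ blockDiag H := by
  rw [← sub_nonneg, blockDiag_sub]
  exact blockDiag_nonneg fun x => sub_nonneg.2 (h x)

lemma sqrt_blockDiag {G : X → Matrix b b ℂ} (hG : ∀ x, 0 ≤ G x) :
    CFC.sqrt (blockDiag G) = blockDiag fun x => CFC.sqrt (G x) := by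
  refine CFC.sqrt_unique ?_ (blockDiag_nonneg fun x => CFC.sqrt_nonneg _)
  rw [blockDiag_mul]
  simp only [CFC.sqrt_mul_sqrt_self _ (hG _)]

lemma norm_blockDiag_le_one {V : X → Matrix b b ℂ} (hV : ∀ x, ‖V x‖ ≤ 1) :
    ‖blockDiag V‖ ≤ 1 := by
  refine norm_le_one_of_conjTranspose_mul_self ?_
  rw [blockDiag_conjTranspose, blockDiag_mul, ← blockDiag_one]
  exact blockDiag_mono fun x => conjTranspose_mul_self_le_one (hV x)

/-- Taking the diagonal blocks is an orthogonal projection for the Hilbert-Schmidt inner product. -/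
lemma sum_re_trace_diagBlock_le (T : Matrix (X × b) (X × b) ℂ) :
    ∑ x, ((diagBlock T x)ᴴ * diagBlock T x).trace.re ≤ (Tᴴ * T).trace.re := by
  set D := blockDiag (diagBlock T)
  have h1 : (Dᴴ * T).trace.re = ∑ x, ((diagBlock T x)ᴴ * diagBlock T x).trace.re := by
    rw [blockDiag_conjTranspose, trace_blockDiag_mul]; simp
  have h2 : (Dᴴ * D).trace.re = ∑ x, ((diagBlock T x)ᴴ * diagBlock T x).trace.re := by
    rw [blockDiag_conjTranspose, trace_blockDiag_mul]; simp [D, diagBlock_blockDiag]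
  have h3 : (Tᴴ * D).trace.re = (Dᴴ * T).trace.re := by
    rw [← re_trace_conjTranspose, conjTranspose_mul, conjTranspose_conjTranspose]
  have h4 := re_trace_nonneg (conjTranspose_mul_self_nonneg (T - D))
  rw [conjTranspose_sub, sub_mul, mul_sub, mul_sub, re_trace_sub, re_trace_sub, re_trace_sub] at h4
  linarith

/-- The blocks of a suitable square root of `τ` give a classical-quantum state that is at least as
close to `ψ` and has no larger fidelity with the operators `1 ⊗ σ`. -/
lemma exists_classical_blocks {ψ : X → Matrix b b ℂ} (hψ : ∀ x, 0 ≤ ψ x)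
    {τ : Matrix (X × b) (X × b) ℂ} (hτ : IsSubState τ) :
    ∃ T : X → Matrix b b ℂ, ∑ x, (T x * (T x)ᴴ).trace.re ≤ 1 ∧
      ∑ x, (CFC.sqrt (ψ x) * T x).trace.re
        = traceNorm (CFC.sqrt (blockDiag ψ) * CFC.sqrt τ) ∧
      ∀ σ : Matrix b b ℂ, 0 ≤ σ → ∑ x, (CFC.sqrt (T x * (T x)ᴴ) * CFC.sqrt σ).trace.re ≤
        traceNorm (CFC.sqrt τ * CFC.sqrt ((1 : Matrix X X ℂ) ⊗ₖ σ)) := by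
  have hτ0 : 0 ≤ τ := Matrix.nonneg_iff_posSemidef.2 hτ.1
  obtain ⟨U, hU, hUt⟩ := exists_re_trace_mul_eq_traceNorm (CFC.sqrt (blockDiag ψ) * CFC.sqrt τ)
  -- `U` turns the trace norm into a trace against a block-diagonal operator, which sees only the
  -- diagonal blocks of `T`.
  set T := CFC.sqrt τ * U with hT
  refine ⟨diagBlock T, ?_, ?_, ?_⟩
  · simp_rw [Matrix.trace_mul_comm (diagBlock T _)]
    refine (sum_re_trace_diagBlock_le T).trans ?_
    rw [hT, conjTranspose_mul, sqrt_conjTranspose, mul_assoc, ← mul_assoc (CFC.sqrt τ),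
      CFC.sqrt_mul_sqrt_self τ hτ0, ← mul_assoc, Matrix.trace_mul_comm, ← mul_assoc]
    refine (re_trace_mul_mono_left (mul_conjTranspose_le_one hU) hτ0).trans ?_
    rw [one_mul]
    exact hτ.2
  · rw [← hUt, sqrt_blockDiag hψ, Matrix.trace_mul_comm U, mul_assoc, trace_blockDiag_mul,
      Complex.re_sum]
  · intro σ hσ
    -- The contractions `V x` assemble into a block-diagonal contraction, so duality bounds the
    -- whole sum by one trace norm.
    choose V hV hVs using fun x => exists_sqrt_mul_conjTranspose (diagBlock T x)
    have e : ∑ x, (CFC.sqrt (diagBlock T x * (diagBlock T x)ᴴ) * CFC.sqrt σ).trace.re =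
        (U * blockDiag V * (CFC.sqrt ((1 : Matrix X X ℂ) ⊗ₖ σ) * CFC.sqrt τ)).trace.re := by
      rw [one_kronecker_eq_blockDiag, sqrt_blockDiag fun _ => hσ, mul_assoc, Matrix.trace_mul_comm U,
        ← mul_assoc, blockDiag_mul, mul_assoc, trace_blockDiag_mul, Complex.re_sum]
      refine Finset.sum_congr rfl fun x _ => ?_
      rw [hVs, mul_assoc, Matrix.trace_mul_comm]
    rw [e]
    refine (re_trace_mul_le_traceNorm
      (norm_mul_le_one hU (norm_blockDiag_le_one hV)) _).trans_eq ?_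
    rw [← traceNorm_conjTranspose, conjTranspose_mul, sqrt_conjTranspose, sqrt_conjTranspose]

/-- After enlarging `t` to `1`, put `p = cos² α`, `q = cos² β`: the bound on `s` is `cos (α - β)`,
while `p - q = sin (β - α) sin (α + β)`. -/
lemma sub_sq_le_one_sub_sq {p q t s : ℝ} (hp : 0 ≤ p) (hp1 : p ≤ 1) (hq : 0 ≤ q) (hqt : q ≤ t)
    (ht : t ≤ 1) (hs0 : 0 ≤ s) (hs : s ≤ √p * √q + √(1 - p) * √(t - q)) :
    (p - q) ^ 2 ≤ 1 - s ^ 2 := by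
  have hd : √(t - q) ≤ √(1 - q) := Real.sqrt_le_sqrt (by linarith)
  have hs' : s ≤ √p * √q + √(1 - p) * √(1 - q) :=
    hs.trans (by gcongr)
  have ha := Real.sq_sqrt hp
  have hb := Real.sq_sqrt hq
  have hc := Real.sq_sqrt (sub_nonneg.2 hp1)
  have hd := Real.sq_sqrt (show 0 ≤ 1 - q by linarith)
  set a := √p
  set c := √q
  set d := √(1 - p)
  set e := √(1 - q)
  have h1 : s ^ 2 ≤ (a * c + d * e) ^ 2 := pow_le_pow_left₀ hs0 hs' 2
  have e1 : p - q = (a * e - c * d) * (a * e + c * d) := by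
    have : (a * e - c * d) * (a * e + c * d) = a ^ 2 * e ^ 2 - c ^ 2 * d ^ 2 := by ring
    rw [this, ha, hb, hc, hd]; ring
  have e2 : 1 - (a * c + d * e) ^ 2 = (a * e - c * d) ^ 2 := by
    have : 1 = (a ^ 2 + d ^ 2) * (c ^ 2 + e ^ 2) := by rw [ha, hb, hc, hd]; ring
    rw [this]; ring
  have e3 : (a * e + c * d) ^ 2 ≤ 1 := by
    have : 1 = (a ^ 2 + d ^ 2) * (c ^ 2 + e ^ 2) := by rw [ha, hb, hc, hd]; ring
    rw [this]
    nlinarith [sq_nonneg (a * c - d * e)]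
  have h2 : (p - q) ^ 2 ≤ (a * e - c * d) ^ 2 := by
    rw [e1, mul_pow]
    exact mul_le_of_le_one_right (sq_nonneg _) e3
  linarith

/-- An event has nearly the same probability under close states. -/
lemma sum_re_trace_test_le {ψ T E : X → Matrix b b ℂ} {δ : ℝ} (hψ : ∀ x, 0 ≤ ψ x)
    (hψ1 : ∑ x, (ψ x).trace.re = 1) (hT : ∑ x, (T x * (T x)ᴴ).trace.re ≤ 1)
    (hE : ∀ x, 0 ≤ E x) (hE1 : ∀ x, E x ≤ 1) (hs0 : 0 ≤ ∑ x, (CFC.sqrt (ψ x) * T x).trace.re)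
    (hδ : 0 ≤ δ) (hs : 1 - (∑ x, (CFC.sqrt (ψ x) * T x).trace.re) ^ 2 ≤ δ ^ 2) :
    ∑ x, (E x * ψ x).trace.re ≤ ∑ x, (E x * (T x * (T x)ᴴ)).trace.re + δ := by
  -- Cauchy-Schwarz for `√D √ψ` and `√D T`, used for `D = E` and `D = 1 - E`: the overlap is at most
  -- that of the two-outcome statistics.
  have key : ∀ D : X → Matrix b b ℂ, (∀ x, 0 ≤ D x) →
      ∑ x, (CFC.sqrt (ψ x) * D x * T x).trace.re ≤
        √(∑ x, (D x * ψ x).trace.re) * √(∑ x, (D x * (T x * (T x)ᴴ)).trace.re) := by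
    intro D hD
    have h := sum_re_trace_le Finset.univ (fun x => CFC.sqrt (D x) * CFC.sqrt (ψ x))
      (fun x => CFC.sqrt (D x) * T x)
    have c1 : ∀ x, (CFC.sqrt (D x) * CFC.sqrt (ψ x))ᴴ * (CFC.sqrt (D x) * T x) =
        CFC.sqrt (ψ x) * D x * T x := fun x => by
      rw [conjTranspose_mul, sqrt_conjTranspose, sqrt_conjTranspose, mul_assoc, mul_assoc,
        ← mul_assoc (CFC.sqrt (D x)), CFC.sqrt_mul_sqrt_self _ (hD x)]
    have c2 : ∀ x, ((CFC.sqrt (D x) * CFC.sqrt (ψ x))ᴴ * (CFC.sqrt (D x) * CFC.sqrt (ψ x))).trace =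
        (D x * ψ x).trace := fun x => by
      rw [conjTranspose_mul, sqrt_conjTranspose, sqrt_conjTranspose, mul_assoc,
        ← mul_assoc (CFC.sqrt (D x)), CFC.sqrt_mul_sqrt_self _ (hD x), Matrix.trace_mul_comm,
        mul_assoc, CFC.sqrt_mul_sqrt_self _ (hψ x)]
    have c3 : ∀ x, ((CFC.sqrt (D x) * T x)ᴴ * (CFC.sqrt (D x) * T x)).trace =
        (D x * (T x * (T x)ᴴ)).trace := fun x => by
      rw [conjTranspose_mul, sqrt_conjTranspose, mul_assoc,
        ← mul_assoc (CFC.sqrt (D x)), CFC.sqrt_mul_sqrt_self _ (hD x), Matrix.trace_mul_comm,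
        mul_assoc]
    simpa only [c1, c2, c3] using h
  have hTT : ∀ x, 0 ≤ T x * (T x)ᴴ := fun x => by
    simpa using conjTranspose_mul_self_nonneg (T x)ᴴ
  have k1 := key E hE
  have k2 := key (fun x => 1 - E x) fun x => sub_nonneg.2 (hE1 x)
  set p := ∑ x, (E x * ψ x).trace.re
  set q := ∑ x, (E x * (T x * (T x)ᴴ)).trace.re
  set s := ∑ x, (CFC.sqrt (ψ x) * T x).trace.re
  set t := ∑ x, (T x * (T x)ᴴ).trace.re
  have e1 : ∑ x, ((1 - E x) * ψ x).trace.re = 1 - p := by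
    simp only [sub_mul, one_mul, re_trace_sub, Finset.sum_sub_distrib, hψ1, p]
  have e2 : ∑ x, ((1 - E x) * (T x * (T x)ᴴ)).trace.re = t - q := by
    simp only [sub_mul, one_mul, re_trace_sub, Finset.sum_sub_distrib, t, q]
  have e3 : s = ∑ x, (CFC.sqrt (ψ x) * E x * T x).trace.re +
      ∑ x, (CFC.sqrt (ψ x) * (1 - E x) * T x).trace.re := by
    rw [← Finset.sum_add_distrib]
    refine Finset.sum_congr rfl fun x _ => ?_
    rw [← re_trace_add]
    congr 2
    noncomm_ring
  have hp : 0 ≤ p := Finset.sum_nonneg fun x _ => re_trace_mul_nonneg (hE x) (hψ x)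
  have hq : 0 ≤ q := Finset.sum_nonneg fun x _ => re_trace_mul_nonneg (hE x) (hTT x)
  have hp1 : 0 ≤ 1 - p := e1 ▸ Finset.sum_nonneg fun x _ =>
    re_trace_mul_nonneg (sub_nonneg.2 (hE1 x)) (hψ x)
  have hq1 : 0 ≤ t - q := e2 ▸ Finset.sum_nonneg fun x _ =>
    re_trace_mul_nonneg (sub_nonneg.2 (hE1 x)) (hTT x)
  rw [e1, e2] at k2
  have h := sub_sq_le_one_sub_sq hp (sub_nonneg.1 hp1) hq (sub_nonneg.1 hq1) hT hs0
    (e3.trans_le (add_le_add k1 k2))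
  have := abs_le_of_sq_le_sq (h.trans hs) hδ
  linarith [le_abs_self (p - q)]

end Blocks

/-! ### The square-root measurement -/

section Decoder

variable {X b : Type*} [Fintype X] [DecidableEq X] [Fintype b] [DecidableEq b]

/-- The square-root measurement for the operators `S x` with `x ∈ s`. -/
lemma exists_povm [Nonempty X] {S : X → Matrix b b ℂ} (hS : ∀ x, 0 ≤ S x) (hS1 : ∀ x, S x ≤ 1)
    (s : Finset X) : ∃ M : Povm X b, ∀ x ∈ s,
      1 - M.op x ≤ 2 • (1 - S x) + 4 • ∑ x' ∈ s.erase x, S x' := by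
  obtain ⟨R, Q, hR, hQ, hQQ, h1, h2, h3, -⟩ := exists_pinv_sqrt (∑ x ∈ s, S x)
  have hH : 0 ≤ ∑ x ∈ s, S x := Finset.sum_nonneg fun x _ => hS x
  have hRHR : R * (∑ x ∈ s, S x) * R = Q := by
    have hKK := CFC.sqrt_mul_sqrt_self _ hH
    calc R * (∑ x ∈ s, S x) * R
        = (R * CFC.sqrt (∑ x ∈ s, S x)) * (CFC.sqrt (∑ x ∈ s, S x) * R) := by
          nth_rw 1 [← hKK]; simp only [mul_assoc]
      _ = Q := by rw [h1, h2, hQQ]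
  have hQ1 : 0 ≤ 1 - Q := sub_nonneg.2 (le_one_of_isIdempotent hQ hQQ)
  have hRSR : ∀ x, 0 ≤ R * S x * R := fun x => by
    simpa [hR] using conjTranspose_mul_mul_nonneg (hS x) R
  -- The leftover `1 - Q` goes to an arbitrary outcome; this only enlarges the operators, so the
  -- error bound survives.
  let x₀ : X := Classical.arbitrary X
  have hite : ∀ x, 0 ≤ if x = x₀ then 1 - Q else 0 := fun x => by split_ifs <;> simp [hQ1]
  refine ⟨⟨fun x => (if x ∈ s then R * S x * R else 0) + if x = x₀ then 1 - Q else 0, ?_, ?_⟩, ?_⟩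
  · intro x
    refine Matrix.nonneg_iff_posSemidef.1 (add_nonneg ?_ (hite x))
    split_ifs
    · exact hRSR x
    · exact le_rfl
  · rw [Finset.sum_add_distrib, Finset.sum_ite_mem, Finset.univ_inter, ← Finset.sum_mul,
      ← Finset.mul_sum, hRHR]
    simp
  · intro x hx
    have hsum : S x + ∑ x' ∈ s.erase x, S x' = ∑ x ∈ s, S x := Finset.add_sum_erase s S hx
    have hn := hayashi_nagaoka (hS x) (hS1 x)
      (Finset.sum_nonneg fun x' _ => hS x' : 0 ≤ ∑ x' ∈ s.erase x, S x') hR hQ hQQ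
      (by rw [hsum, h1]) (by rw [hsum, h2]) (by rw [hsum, h3])
    refine le_trans ?_ hn
    simp only [hx, if_true]
    refine sub_le_sub_left ?_ 1
    exact le_add_of_nonneg_right (hite x)

lemma Povm.op_nonneg (M : Povm X b) (x : X) : 0 ≤ M.op x :=
  Matrix.nonneg_iff_posSemidef.2 (M.posSemidef x)

lemma Povm.op_le_one (M : Povm X b) (x : X) : M.op x ≤ 1 := by
  rw [← M.sum_eq_one]
  exact Finset.single_le_sum (fun y _ => M.op_nonneg y) (Finset.mem_univ x)

lemma Povm.sum_prob_ne (M : Povm X b) (ρ : Matrix b b ℂ) (x : X) :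
    ∑ x' ∈ Finset.univ.filter (fun x' => x' ≠ x), M.prob ρ x' = ((1 - M.op x) * ρ).trace.re := by
  have h : ∑ x', M.prob ρ x' = ρ.trace.re := by
    simp only [Povm.prob]
    rw [← re_trace_sum, ← Finset.sum_mul, M.sum_eq_one, one_mul]
  rw [sub_mul, one_mul, re_trace_sub, ← h, Finset.filter_ne',
    ← Finset.add_sum_erase _ _ (Finset.mem_univ x)]
  simp [Povm.prob]

end Decoder

/-! ### Average error over a 2-universal family -/

section Coding

variable {X b : Type*} [Fintype X] [DecidableEq X] [Fintype b] [DecidableEq b]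

/-- After exchanging sums, each pair `x' ≠ x` is counted for at most a fraction `2^(-m)` of `F`; the
diagonal terms on the right are nonnegative extras. -/
lemma sum_hash_collisions_le {m : ℕ} {F : Finset (X → (Fin m → Bool))} (hF : IsTwoUniversal F)
    {w : X → X → ℝ} (hw : ∀ x x', 0 ≤ w x x') :
    ∑ f ∈ F, ∑ x, ∑ x' ∈ (Finset.univ.filter fun y => f y = f x).erase x, w x x' ≤
      F.card * (((2 : ℝ) ^ m)⁻¹ * ∑ x, ∑ x', w x x') := by
  have hc : (0 : ℝ) < F.card := by exact_mod_cast hF.1.card_pos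
  rw [Finset.sum_comm, Finset.mul_sum, Finset.mul_sum]
  refine Finset.sum_le_sum fun x _ => ?_
  have e : ∀ f : X → (Fin m → Bool),
      ∑ x' ∈ (Finset.univ.filter fun y => f y = f x).erase x, w x x' =
        ∑ x', if x' ≠ x ∧ f x' = f x then w x x' else 0 := by
    intro f
    rw [← Finset.sum_filter]
    refine Finset.sum_congr ?_ fun _ _ => rfl
    ext y; simp
  simp_rw [e]
  rw [Finset.sum_comm, Finset.mul_sum, Finset.mul_sum]
  refine Finset.sum_le_sum fun x' _ => ?_
  by_cases hx : x' = x
  · subst hx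
    simp only [ne_eq, not_true_eq_false, false_and, if_false, Finset.sum_const_zero]
    have := hw x' x'
    positivity
  · simp only [ne_eq, hx, not_false_eq_true, true_and]
    rw [← Finset.sum_filter, Finset.sum_const, nsmul_eq_mul, ← mul_assoc]
    refine mul_le_mul_of_nonneg_right ?_ (hw x x')
    have := hF.2 x' x hx
    rw [div_le_iff₀ hc] at this
    linarith

/-- A state dominating a given operator of trace at most one. -/
lemma exists_isState_ge [Nonempty b] {ρ : Matrix b b ℂ} (hρ : 0 ≤ ρ) (h : ρ.trace.re ≤ 1) :
    ∃ σ : Matrix b b ℂ, IsState σ ∧ ρ ≤ σ := by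
  -- The missing trace is spread evenly over the identity.
  set r : ℝ := (1 - ρ.trace.re) / Fintype.card b with hr
  have hcard : (Fintype.card b : ℝ) ≠ 0 := by exact_mod_cast Fintype.card_ne_zero
  have h0 : 0 ≤ r • (1 : Matrix b b ℂ) :=
    smul_nonneg (div_nonneg (sub_nonneg.2 h) (Nat.cast_nonneg _)) zero_le_one
  refine ⟨ρ + r • 1, ⟨Matrix.nonneg_iff_posSemidef.1 (add_nonneg hρ h0), ?_⟩,
    le_add_of_nonneg_right h0⟩
  have him : ρ.trace.im = 0 :=
    (Complex.nonneg_iff.1 (Matrix.nonneg_iff_posSemidef.1 hρ).trace_nonneg).2.symm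
  apply Complex.ext
  · rw [re_trace_add, re_trace_smul, Matrix.trace_one, Complex.natCast_re, hr, div_mul_cancel₀ _ hcard]
    simp
  · simp [him]

/-- The tests that distinguish the blocks of a smoothed state from their average. -/
lemma exists_tests [Nonempty b] {ρ : X → Matrix b b ℂ} (hρ : ∀ x, 0 ≤ ρ x)
    (hρ1 : ∑ x, (ρ x).trace.re ≤ 1) {K N : ℝ} (hN : 0 < N)
    (hK : ∀ σ, IsState σ → ∑ x, (CFC.sqrt (ρ x) * CFC.sqrt σ).trace.re ≤ √K) :
    ∃ S : X → Matrix b b ℂ, (∀ x, 0 ≤ S x) ∧ (∀ x, S x ≤ 1) ∧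
      2 * ∑ x, ((1 - S x) * ρ x).trace.re + 4 * (N⁻¹ * ∑ x, ∑ x', (S x' * ρ x).trace.re) ≤
        √(8 * K / N) := by
  have hsum0 : 0 ≤ ∑ x, ρ x := Finset.sum_nonneg fun x _ => hρ x
  obtain ⟨σ, hσ, hσge⟩ := exists_isState_ge hsum0 (by rwa [re_trace_sum])
  have hσ0 : 0 ≤ σ := Matrix.nonneg_iff_posSemidef.2 hσ.1
  have hN2 : 0 ≤ 2 / N := by positivity
  -- The weight `2 / N` makes twice the test bound reproduce the coefficients `2` and `4 / N`.
  choose S hS hS1 hSt using fun x => exists_test_le (hρ x) (smul_nonneg hN2 hσ0)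
  refine ⟨S, hS, hS1, ?_⟩
  have hsq : CFC.sqrt ((2 / N) • σ) = √(2 / N) • CFC.sqrt σ := by
    refine CFC.sqrt_unique ?_ (smul_nonneg (Real.sqrt_nonneg _) (CFC.sqrt_nonneg _))
    rw [smul_mul_smul_comm, Real.mul_self_sqrt hN2, CFC.sqrt_mul_sqrt_self σ hσ0]
  have h1 : ∑ x, ((1 - S x) * ρ x).trace.re + (2 / N) * ∑ x, (S x * σ).trace.re ≤
      √(2 / N) * √K := by
    refine le_trans ?_ (mul_le_mul_of_nonneg_left (hK σ hσ) (Real.sqrt_nonneg _))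
    rw [Finset.mul_sum, Finset.mul_sum, ← Finset.sum_add_distrib]
    refine Finset.sum_le_sum fun x _ => ?_
    have := hSt x
    rwa [hsq, mul_smul_comm, mul_smul_comm, re_trace_smul, re_trace_smul] at this
  have h2 : ∑ x, ∑ x', (S x' * ρ x).trace.re ≤ ∑ x, (S x * σ).trace.re := by
    rw [Finset.sum_comm]
    refine Finset.sum_le_sum fun x _ => ?_
    rw [← re_trace_sum, ← Finset.mul_sum]
    exact re_trace_mul_mono_right hσge (hS x)
  have h3 : √(8 * K / N) = 2 * (√(2 / N) * √K) := by
    rw [← Real.sqrt_mul hN2, show 8 * K / N = 2 ^ 2 * (2 / N * K) by ring,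
      Real.sqrt_mul (by positivity), Real.sqrt_sq (by norm_num)]
  rw [h3]
  have h4 : N⁻¹ * ∑ x, ∑ x', (S x' * ρ x).trace.re ≤ N⁻¹ * ∑ x, (S x * σ).trace.re :=
    mul_le_mul_of_nonneg_left h2 (by positivity)
  have e : (2 / N) * ∑ x, (S x * σ).trace.re = 2 * (N⁻¹ * ∑ x, (S x * σ).trace.re) := by ring
  rw [e] at h1
  linarith

/-- For every hash function there is a decoder such that the error probability is small on average
over a 2-universal family. -/
lemma exists_decoders [Nonempty X] [Nonempty b] {m : ℕ} {F : Finset (X → (Fin m → Bool))}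
    (hF : IsTwoUniversal F) {P : X → ℝ} (hP : ∀ x, 0 ≤ P x) (hP1 : ∑ x, P x = 1)
    {φ : X → Matrix b b ℂ} (hφ : ∀ x, IsState (φ x)) {δ K : ℝ} (hδ : 0 ≤ δ)
    {τ : Matrix (X × b) (X × b) ℂ} (hτ : τ ∈ ball δ (cqState P φ))
    (hK : ∀ σ : Matrix b b ℂ, IsState σ → fidelity τ ((1 : Matrix X X ℂ) ⊗ₖ σ) ≤ K) :
    ∃ D : (X → (Fin m → Bool)) → (Fin m → Bool) → Povm X b,
      ∑ f ∈ F, ∑ x, P x * ∑ x' ∈ Finset.univ.filter (fun x' => x' ≠ x),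
        (D f (f x)).prob (φ x) x' ≤ F.card * (δ + √(8 * K / 2 ^ m)) := by
  have hφ0 : ∀ x, 0 ≤ φ x := fun x => Matrix.nonneg_iff_posSemidef.2 (hφ x).1
  set ψ : X → Matrix b b ℂ := fun x => P x • φ x with hψdef
  have hψ : ∀ x, 0 ≤ ψ x := fun x => smul_nonneg (hP x) (hφ0 x)
  have hψ1 : ∑ x, (ψ x).trace.re = 1 := by
    simp only [ψ, re_trace_smul, (hφ _).2, Complex.one_re, mul_one, hP1]
  obtain ⟨hτs, hτd⟩ := hτ
  obtain ⟨T, hT1, hTψ, hTσ⟩ := exists_classical_blocks hψ hτs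
  have hTT : ∀ x, 0 ≤ T x * (T x)ᴴ := fun x => by
    simpa using conjTranspose_mul_self_nonneg (T x)ᴴ
  obtain ⟨S, hS, hS1, hSb⟩ := exists_tests hTT hT1 (N := 2 ^ m) (K := K) (by positivity)
    fun σ hσ => (hTσ σ (Matrix.nonneg_iff_posSemidef.2 hσ.1)).trans (Real.le_sqrt_of_sq_le (hK σ hσ))
  choose D hD using fun (f : X → (Fin m → Bool)) (c : Fin m → Bool) =>
    exists_povm hS hS1 (Finset.univ.filter fun y => f y = c)
  refine ⟨D, ?_⟩
  have hs0 : 0 ≤ ∑ x, (CFC.sqrt (ψ x) * T x).trace.re := hTψ ▸ traceNorm_nonneg _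
  have hs : 1 - (∑ x, (CFC.sqrt (ψ x) * T x).trace.re) ^ 2 ≤ δ ^ 2 := by
    rw [hTψ, ← cqState_eq_blockDiag]
    exact (Real.sqrt_le_left hδ).1 hτd
  have herr : ∀ f : X → (Fin m → Bool),
      ∑ x, P x * ∑ x' ∈ Finset.univ.filter (fun x' => x' ≠ x), (D f (f x)).prob (φ x) x' ≤
        2 * ∑ x, ((1 - S x) * (T x * (T x)ᴴ)).trace.re +
        4 * ∑ x, ∑ x' ∈ (Finset.univ.filter fun y => f y = f x).erase x,
          (S x' * (T x * (T x)ᴴ)).trace.re + δ := by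
    intro f
    have e : ∑ x, P x * ∑ x' ∈ Finset.univ.filter (fun x' => x' ≠ x), (D f (f x)).prob (φ x) x' =
        ∑ x, ((1 - (D f (f x)).op x) * ψ x).trace.re := by
      refine Finset.sum_congr rfl fun x _ => ?_
      rw [Povm.sum_prob_ne, hψdef, mul_smul_comm, re_trace_smul]
    rw [e]
    -- The error is the weight of the event `1 - op`, so passing from `ψ x` to `T x (T x)ᴴ` costs at
    -- most `δ`.
    refine (sum_re_trace_test_le (E := fun x => 1 - (D f (f x)).op x) hψ hψ1 hT1
      (fun x => sub_nonneg.2 (Povm.op_le_one _ _))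
      (fun x => sub_le_self _ (Povm.op_nonneg _ _)) hs0 hδ hs).trans ?_
    refine add_le_add_left ?_ δ
    rw [Finset.mul_sum, Finset.mul_sum, ← Finset.sum_add_distrib]
    refine Finset.sum_le_sum fun x _ => ?_
    refine (re_trace_mul_mono_left (hD f (f x) x (by simp)) (hTT x)).trans_eq ?_
    rw [add_mul, re_trace_add, smul_mul_assoc, smul_mul_assoc, Finset.sum_mul, Matrix.trace_smul,
      Matrix.trace_smul, ← re_trace_sum]
    simp
  refine (Finset.sum_le_sum fun f _ => herr f).trans ?_
  have hw := sum_hash_collisions_le hF (w := fun x x' => (S x' * (T x * (T x)ᴴ)).trace.re)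
    fun x x' => re_trace_mul_nonneg (hS x') (hTT x)
  rw [Finset.sum_add_distrib, Finset.sum_add_distrib, ← Finset.mul_sum, ← Finset.mul_sum,
    Finset.sum_const, Finset.sum_const, nsmul_eq_mul, nsmul_eq_mul]
  have := mul_le_mul_of_nonneg_left hSb (Nat.cast_nonneg F.card : (0 : ℝ) ≤ F.card)
  linarith

/-- Overwriting the value at `x` loses nothing when `f x = f x'`, since it can be read off at `x'`.
Hence colliding functions times `2^m` is at most the number of all functions. -/
lemma isTwoUniversal_univ {m : ℕ} :
    IsTwoUniversal (Finset.univ : Finset (X → (Fin m → Bool))) := by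
  refine ⟨Finset.univ_nonempty, fun x x' hx => ?_⟩
  have hinj : Function.Injective
      (fun p : {f : X → (Fin m → Bool) // f x = f x'} × (Fin m → Bool) =>
        Function.update p.1.1 x p.2) := by
    rintro ⟨⟨f, hf⟩, c⟩ ⟨⟨g, hg⟩, d⟩ h
    have hfg : ∀ y, Function.update f x c y = Function.update g x d y := congrFun h
    have hcd : c = d := by simpa using hfg x
    have hy : ∀ y, y ≠ x → f y = g y := fun y hy => by simpa [hy] using hfg y
    have : f = g := by
      funext y
      by_cases h : y = x
      · rw [h, hf, hg, hy x' (Ne.symm hx)]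
      · exact hy y h
    subst this; subst hcd; rfl
  have hc := Fintype.card_le_of_injective _ hinj
  rw [Fintype.card_prod, Fintype.card_subtype] at hc
  have h2 : Fintype.card (Fin m → Bool) = 2 ^ m := by simp
  rw [h2] at hc
  rw [div_le_iff₀ (by rw [Finset.card_univ]; exact_mod_cast Fintype.card_pos), inv_mul_eq_div,
    le_div_iff₀ (by positivity), Finset.card_univ]
  exact_mod_cast hc

end Coding

/-! ### Fidelity bounds and finiteness of the smooth max-entropy -/

section Entropy

variable {X b : Type*} [Fintype X] [DecidableEq X] [Fintype b] [DecidableEq b]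

lemma fidelity_nonneg {n : Type*} [Fintype n] [DecidableEq n] (ρ σ : Matrix n n ℂ) :
    0 ≤ fidelity ρ σ := sq_nonneg _

lemma fidelity_comm {n : Type*} [Fintype n] [DecidableEq n] (ρ σ : Matrix n n ℂ) :
    fidelity ρ σ = fidelity σ ρ := by
  unfold fidelity
  rw [← traceNorm_conjTranspose, conjTranspose_mul, sqrt_conjTranspose, sqrt_conjTranspose]

lemma fidelity_self {n : Type*} [Fintype n] [DecidableEq n] {ρ : Matrix n n ℂ} (hρ : 0 ≤ ρ) :
    fidelity ρ ρ = ρ.trace.re ^ 2 := by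
  unfold fidelity traceNorm
  rw [CFC.sqrt_mul_sqrt_self ρ hρ, conjTranspose_eq_of_nonneg hρ, CFC.sqrt_mul_self ρ hρ]

/-- The trace norm is `Tr √(√σ ρ √σ)`, and the square root is operator monotone. -/
lemma fidelity_mono_left {n : Type*} [Fintype n] [DecidableEq n] {ρ ρ' : Matrix n n ℂ}
    (hρ : 0 ≤ ρ) (h : ρ ≤ ρ') (σ : Matrix n n ℂ) : fidelity ρ σ ≤ fidelity ρ' σ := by
  have e : ∀ ω : Matrix n n ℂ, 0 ≤ ω → (CFC.sqrt ω * CFC.sqrt σ)ᴴ * (CFC.sqrt ω * CFC.sqrt σ) =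
      CFC.sqrt σ * ω * CFC.sqrt σ := fun ω hω => by
    rw [conjTranspose_mul, sqrt_conjTranspose, sqrt_conjTranspose, mul_assoc,
      ← mul_assoc (CFC.sqrt ω), CFC.sqrt_mul_sqrt_self ω hω, mul_assoc]
  refine pow_le_pow_left₀ (traceNorm_nonneg _) ?_ 2
  unfold traceNorm
  rw [e ρ hρ, e ρ' (hρ.trans h)]
  refine re_trace_mono (CFC.sqrt_le_sqrt _ _ ?_)
  have := conjTranspose_mul_mul_nonneg (sub_nonneg.2 h) (CFC.sqrt σ)
  rw [sqrt_conjTranspose, mul_sub, sub_mul] at this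
  exact sub_nonneg.1 this

lemma fidelity_le {n : Type*} [Fintype n] [DecidableEq n] {ρ σ : Matrix n n ℂ}
    (hρ : 0 ≤ ρ) (hσ : 0 ≤ σ) : fidelity ρ σ ≤ ρ.trace.re * σ.trace.re := by
  obtain ⟨U, hU, h⟩ := exists_re_trace_mul_eq_traceNorm (CFC.sqrt ρ * CFC.sqrt σ)
  have hcs := sum_re_trace_le {()} (fun _ => (U * CFC.sqrt ρ)ᴴ) (fun _ => CFC.sqrt σ)
  simp only [Finset.sum_singleton, conjTranspose_conjTranspose, sqrt_conjTranspose,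
    CFC.sqrt_mul_sqrt_self σ hσ] at hcs
  rw [mul_assoc, h] at hcs
  have h1 : (U * CFC.sqrt ρ * (U * CFC.sqrt ρ)ᴴ).trace.re ≤ ρ.trace.re := by
    rw [conjTranspose_mul, sqrt_conjTranspose, mul_assoc, ← mul_assoc (CFC.sqrt ρ),
      CFC.sqrt_mul_sqrt_self ρ hρ, Matrix.trace_mul_comm, mul_assoc, Matrix.trace_mul_comm]
    refine (re_trace_mul_mono_left (conjTranspose_mul_self_le_one hU) hρ).trans ?_
    rw [one_mul]
  have h2 := hcs.trans (mul_le_mul_of_nonneg_right (Real.sqrt_le_sqrt h1) (Real.sqrt_nonneg _))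
  have h3 := pow_le_pow_left₀ (traceNorm_nonneg _) h2 2
  rwa [mul_pow, Real.sq_sqrt (re_trace_nonneg hρ), Real.sq_sqrt (re_trace_nonneg hσ)] at h3

lemma log2_of_pos {x : ℝ} (hx : 0 < x) : log2 x = (Real.logb 2 x : EReal) := if_neg hx.ne'

lemma log2_le_iff {x h : ℝ} (hx : 0 ≤ x) : log2 x ≤ (h : EReal) ↔ x ≤ 2 ^ h := by
  rcases hx.eq_or_lt with rfl | hx
  · simp [log2, Real.rpow_nonneg]
  · rw [log2_of_pos hx, EReal.coe_le_coe_iff, Real.logb_le_iff_le_rpow (by norm_num) hx]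

lemma Hmax_le_iff {a : Type*} [Fintype a] [DecidableEq a] {ρ : Matrix (a × b) (a × b) ℂ} {h : ℝ} :
    Hmax ρ ≤ (h : EReal) ↔
      ∀ σ : Matrix b b ℂ, IsState σ → fidelity ρ ((1 : Matrix a a ℂ) ⊗ₖ σ) ≤ 2 ^ h := by
  simp only [Hmax, iSup_le_iff, Set.mem_ofPred_eq, log2_le_iff (fidelity_nonneg _ _)]

variable {P : X → ℝ} {φ : X → Matrix b b ℂ}

lemma cqState_nonneg (hP : ∀ x, 0 ≤ P x) (hφ : ∀ x, IsState (φ x)) : 0 ≤ cqState P φ := by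
  rw [cqState_eq_blockDiag]
  exact blockDiag_nonneg fun x =>
    smul_nonneg (hP x) (Matrix.nonneg_iff_posSemidef.2 (hφ x).1)

lemma trace_cqState (hP1 : ∑ x, P x = 1) (hφ : ∀ x, IsState (φ x)) : (cqState P φ).trace = 1 := by
  rw [cqState_eq_blockDiag, trace_blockDiag]
  simp only [Matrix.trace_smul, (hφ _).2]
  rw [← Finset.sum_smul, hP1, one_smul]

lemma cqState_mem_ball (hP : ∀ x, 0 ≤ P x) (hP1 : ∑ x, P x = 1) (hφ : ∀ x, IsState (φ x))
    {δ : ℝ} (hδ : 0 ≤ δ) : cqState P φ ∈ ball δ (cqState P φ) := by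
  have h0 := cqState_nonneg hP hφ
  have h1 := trace_cqState hP1 hφ
  refine ⟨⟨Matrix.nonneg_iff_posSemidef.1 h0, by simp [h1]⟩, ?_⟩
  simpa [purifiedDist, fidelity_self h0, h1] using hδ

/-- The state lies in its own ball, and its fidelity with `1 ⊗ σ` is at most the product of the
traces, which is the size of `X`. -/
lemma smoothHmax_lt_top [Nonempty X] (hP : ∀ x, 0 ≤ P x) (hP1 : ∑ x, P x = 1)
    (hφ : ∀ x, IsState (φ x)) {δ : ℝ} (hδ : 0 ≤ δ) : smoothHmax δ (cqState P φ) < ⊤ := by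
  have hc : (0 : ℝ) < Fintype.card X := by exact_mod_cast Fintype.card_pos
  have h : Hmax (cqState P φ) ≤ (Real.logb 2 (Fintype.card X) : EReal) := by
    refine Hmax_le_iff.2 fun σ hσ => ?_
    have hσ0 : 0 ≤ σ := Matrix.nonneg_iff_posSemidef.2 hσ.1
    rw [Real.rpow_logb (by norm_num) (by norm_num) hc]
    have h1 : 0 ≤ (1 : Matrix X X ℂ) ⊗ₖ σ := by
      rw [one_kronecker_eq_blockDiag]
      exact blockDiag_nonneg fun _ => hσ0
    refine (fidelity_le (cqState_nonneg hP hφ) h1).trans_eq ?_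
    rw [trace_cqState hP1 hφ, Matrix.trace_kronecker, hσ.2]
    simp
  exact (iInf₂_le _ (cqState_mem_ball hP hP1 hφ hδ)).trans_lt (h.trans_lt (EReal.coe_lt_top _))

/-- A classical-quantum state lies below `1 ⊗ σ` for its own marginal `σ`; so every `τ` in the ball
has fidelity at least `1 - δ²` with that operator. -/
lemma le_smoothHmax (hP : ∀ x, 0 ≤ P x) (hP1 : ∑ x, P x = 1)
    (hφ : ∀ x, IsState (φ x)) {δ : ℝ} (hδ : 0 ≤ δ) (hδ1 : δ < 1) :
    (Real.logb 2 (1 - δ ^ 2) : EReal) ≤ smoothHmax δ (cqState P φ) := by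
  have hψ : ∀ x, 0 ≤ P x • φ x := fun x =>
    smul_nonneg (hP x) (Matrix.nonneg_iff_posSemidef.2 (hφ x).1)
  have hpos : 0 < 1 - δ ^ 2 := by nlinarith
  refine le_iInf₂ fun τ hτ => ?_
  have hF : 1 - δ ^ 2 ≤ fidelity (cqState P φ) τ := by
    have := (Real.sqrt_le_left hδ).1 hτ.2
    linarith
  set σ := ∑ x, P x • φ x
  have hσ : IsState σ := by
    refine ⟨Matrix.nonneg_iff_posSemidef.1 (Finset.sum_nonneg fun x _ => hψ x), ?_⟩
    simp only [σ, Matrix.trace_sum, Matrix.trace_smul, (hφ _).2]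
    rw [← Finset.sum_smul, hP1, one_smul]
  have hle : cqState P φ ≤ (1 : Matrix X X ℂ) ⊗ₖ σ := by
    rw [one_kronecker_eq_blockDiag, cqState_eq_blockDiag]
    exact blockDiag_mono fun x =>
      Finset.single_le_sum (f := fun x => P x • φ x) (fun y _ => hψ y) (Finset.mem_univ x)
  have h2 : 1 - δ ^ 2 ≤ fidelity τ ((1 : Matrix X X ℂ) ⊗ₖ σ) := by
    rw [fidelity_comm]
    exact hF.trans (fidelity_mono_left (cqState_nonneg hP hφ) hle τ)
  refine le_trans ?_ (le_iSup₂ (f := fun (σ : Matrix b b ℂ) (_ : σ ∈ {σ : Matrix b b ℂ | IsState σ})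
    => log2 (fidelity τ ((1 : Matrix X X ℂ) ⊗ₖ σ))) σ hσ)
  rw [log2_of_pos (hpos.trans_le h2)]
  exact EReal.coe_le_coe_iff.2 (Real.logb_le_logb_of_le (by norm_num) hpos h2)

end Entropy

/-! ### One encoder for all decoders -/

/-- An alphabet that is large enough for the smooth max-entropy contains, for every 2-universal
family, an encoder that serves all decoders. -/
lemma exists_good_code {k : ℕ} [NeZero k] {X : Type*} [Fintype X] [DecidableEq X] [Nonempty X]
    {B : Fin k → Type*} [∀ i, Fintype (B i)] [∀ i, DecidableEq (B i)] [∀ i, Nonempty (B i)]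
    {P : X → ℝ} (hP : ∀ x, 0 ≤ P x) (hP1 : ∑ x, P x = 1)
    {φ : ∀ i, X → Matrix (B i) (B i) ℂ} (hφ : ∀ i x, IsState (φ i x))
    {ε δ γ : ℝ} (hδ : 0 ≤ δ) (hγ : 0 < γ) (hε : k * δ + (k + 1) * γ ≤ ε) {m : ℕ} {H : Fin k → ℝ}
    (hH : ∀ i, smoothHmax δ (cqState P (φ i)) = (H i : EReal))
    (hm : ∀ i, H i - 2 * Real.logb 2 γ + 3 ≤ m)
    {F : Finset (X → (Fin m → Bool))} (hF : IsTwoUniversal F) :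
    ∃ S : SourceCode X (Fin m → Bool) B, S.enc ∈ F ∧ S.IsGood P φ ε := by
  have hk : (0 : ℝ) < k := by exact_mod_cast Nat.pos_of_ne_zero (NeZero.ne k)
  have hr1 : 1 < ((k : ℝ) + 1) / k := by rw [lt_div_iff₀ hk]; linarith
  -- Slack that avoids attaining the infimum: it multiplies `γ` by `(k+1)/k`, so the `k` decoders
  -- use `(k+1) γ` in total instead of `k γ`.
  set η : ℝ := 2 * Real.logb 2 (((k : ℝ) + 1) / k) with hη
  have hη0 : 0 < η := mul_pos two_pos (Real.logb_pos (by norm_num) hr1)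
  have hτ : ∀ i, ∃ τ ∈ ball δ (cqState P (φ i)), Hmax τ ≤ ((H i + η : ℝ) : EReal) := by
    intro i
    have h : smoothHmax δ (cqState P (φ i)) < ((H i + η : ℝ) : EReal) := by
      rw [hH i, EReal.coe_lt_coe_iff]; linarith
    simp only [smoothHmax, iInf_lt_iff] at h
    obtain ⟨τ, hτ, h⟩ := h
    exact ⟨τ, hτ, h.le⟩
  choose τ hτ hτH using hτ
  choose D hD using fun i =>
    exists_decoders hF hP hP1 (hφ i) hδ (hτ i) (Hmax_le_iff.1 (hτH i))
  have hb : ∀ i, √(8 * 2 ^ (H i + η) / 2 ^ m) ≤ γ * (((k : ℝ) + 1) / k) := by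
    intro i
    have hR : (0 : ℝ) < ((k : ℝ) + 1) / k := by linarith
    refine Real.sqrt_le_iff.2 ⟨by positivity, ?_⟩
    have e : (γ * (((k : ℝ) + 1) / k)) ^ 2 = (2 : ℝ) ^ (2 * Real.logb 2 γ + η) := by
      rw [hη, ← mul_add, ← Real.logb_mul hγ.ne' hR.ne', mul_comm (2 : ℝ), Real.rpow_mul two_pos.le,
        Real.rpow_logb two_pos (by norm_num) (mul_pos hγ hR), Real.rpow_two]
    have e8 : (8 : ℝ) = 2 ^ (3 : ℝ) := by norm_num
    rw [e, div_le_iff₀ (by positivity), ← Real.rpow_natCast, e8, ← Real.rpow_add two_pos,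
      ← Real.rpow_add two_pos]
    exact Real.rpow_le_rpow_of_exponent_le (by norm_num) (by linarith [hm i])
  let S : (X → (Fin m → Bool)) → SourceCode X (Fin m → Bool) B :=
    fun f => ⟨f, fun i => D i f⟩
  have hS : ∀ i, ∑ f ∈ F, (S f).errorAt P φ i ≤ F.card * (δ + γ * (((k : ℝ) + 1) / k)) :=
    fun i => (hD i).trans (by gcongr; exact hb i)
  have htot : ∑ f ∈ F, ∑ i, (S f).errorAt P φ i ≤ ∑ _f ∈ F, ε := by
    rw [Finset.sum_comm]
    refine (Finset.sum_le_sum fun i _ => hS i).trans ?_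
    rw [Finset.sum_const, Finset.sum_const, Finset.card_univ, Fintype.card_fin, nsmul_eq_mul,
      nsmul_eq_mul, mul_left_comm]
    refine mul_le_mul_of_nonneg_left ?_ (Nat.cast_nonneg _)
    refine le_trans (le_of_eq ?_) hε
    field_simp
  obtain ⟨f, hf, hle⟩ := Finset.exists_le_of_sum_le hF.1 htot
  refine ⟨S f, hf, Finset.sup'_le _ _ fun i _ => le_trans ?_ hle⟩
  refine Finset.single_le_sum (f := fun i => (S f).errorAt P φ i) (fun j _ => ?_)
    (Finset.mem_univ i)
  refine Finset.sum_nonneg fun x _ => mul_nonneg (hP x) (Finset.sum_nonneg fun x' _ => ?_)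
  exact re_trace_mul_nonneg (Povm.op_nonneg _ _) (Matrix.nonneg_iff_posSemidef.2 (hφ j x).1)

end CQ

theorem mainTheorem8 {k : ℕ} [NeZero k] {X : Type*} [Fintype X] [DecidableEq X]
    {B : Fin k → Type*} [∀ i, Fintype (B i)] [∀ i, DecidableEq (B i)]
    (P : X → ℝ) (hP_nonneg : ∀ x, 0 ≤ P x) (hP_sum : ∑ x, P x = 1)
    (φ : ∀ i, X → Matrix (B i) (B i) ℂ) (hφ : ∀ i x, CQ.IsState (φ i x))
    (ε ε₁ ε₂ : ℝ) (hε_pos : 0 < ε) (hε_le : ε ≤ 1) (hε₁ : 0 ≤ ε₁) (hε₂ : 0 < ε₂)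
    (hsum : ε₁ + ε₂ / ((k : ℝ) + 1) = ε / ((k : ℝ) + 1)) :
    (∀ i, CQ.smoothHmax ε₁ (CQ.cqState P (φ i)) ≠ ⊥ ∧
      CQ.smoothHmax ε₁ (CQ.cqState P (φ i)) ≠ ⊤) ∧
    ∃ m : ℕ,
      Real.logb 2 (Fintype.card (Fin m → Bool)) =
        ((Finset.univ.sup' Finset.univ_nonempty (fun i : Fin k =>
          ⌈(CQ.smoothHmax ε₁ (CQ.cqState P (φ i))).toReal
            - 2 * Real.logb 2 ε₂ + 2 * Real.logb 2 ((k : ℝ) + 1)⌉) + 3 : ℤ) : ℝ) ∧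
      (∃ S : CQ.SourceCode X (Fin m → Bool) B, S.IsGood P φ ε) ∧
      ∀ F : Finset (X → (Fin m → Bool)), CQ.IsTwoUniversal F →
        ∃ S : CQ.SourceCode X (Fin m → Bool) B, S.enc ∈ F ∧ S.IsGood P φ ε := by
  have hk : (1 : ℝ) ≤ k := by exact_mod_cast Nat.pos_of_ne_zero (NeZero.ne k)
  have hk1 : (0 : ℝ) < (k : ℝ) + 1 := by linarith
  have hsum' : ((k : ℝ) + 1) * ε₁ + ε₂ = ε := by
    field_simp at hsum
    linarith
  -- From `k + 1 ≥ 2` and `(k+1) ε₁ < ε ≤ 1`.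
  have hε₁2 : ε₁ < 1 / 2 := by nlinarith
  have hε₂1 : ε₂ ≤ 1 := by nlinarith
  have hX : Nonempty X := by
    by_contra h
    rw [not_nonempty_iff] at h
    simp at hP_sum
  have hB : ∀ i, Nonempty (B i) := by
    intro i
    by_contra h
    rw [not_nonempty_iff] at h
    have := (hφ i (Classical.arbitrary X)).2
    simp [Matrix.trace] at this
  have hlow := fun i => CQ.le_smoothHmax hP_nonneg hP_sum (hφ i) hε₁ (by linarith)
  have hbot : ∀ i, CQ.smoothHmax ε₁ (CQ.cqState P (φ i)) ≠ ⊥ := fun i =>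
    ((EReal.bot_lt_coe _).trans_le (hlow i)).ne'
  have htop : ∀ i, CQ.smoothHmax ε₁ (CQ.cqState P (φ i)) ≠ ⊤ := fun i =>
    (CQ.smoothHmax_lt_top hP_nonneg hP_sum (hφ i) hε₁).ne
  refine ⟨fun i => ⟨hbot i, htop i⟩, ?_⟩
  set H : Fin k → ℝ := fun i => (CQ.smoothHmax ε₁ (CQ.cqState P (φ i))).toReal
  have hH : ∀ i, CQ.smoothHmax ε₁ (CQ.cqState P (φ i)) = (H i : EReal) := fun i =>
    (EReal.coe_toReal (htop i) (hbot i)).symm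
  set M : ℤ := Finset.univ.sup' Finset.univ_nonempty fun i : Fin k =>
    ⌈H i - 2 * Real.logb 2 ε₂ + 2 * Real.logb 2 ((k : ℝ) + 1)⌉
  have hM : ∀ i, H i - 2 * Real.logb 2 ε₂ + 2 * Real.logb 2 ((k : ℝ) + 1) ≤ M := fun i =>
    (Int.le_ceil _).trans (Int.cast_le.2 (Finset.le_sup' (fun i : Fin k =>
      ⌈H i - 2 * Real.logb 2 ε₂ + 2 * Real.logb 2 ((k : ℝ) + 1)⌉) (Finset.mem_univ i)))
  -- The entropy is at least `log (1 - ε₁²) ≥ -1` and the other two terms are nonnegative.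
  have hM0 : 0 ≤ M + 3 := by
    let i : Fin k := ⟨0, Nat.pos_of_ne_zero (NeZero.ne k)⟩
    have h1 : Real.logb 2 (1 - ε₁ ^ 2) ≤ H i := by
      have := hlow i
      rwa [hH i, EReal.coe_le_coe_iff] at this
    have h2 : -1 ≤ Real.logb 2 (1 - ε₁ ^ 2) := by
      rw [Real.le_logb_iff_rpow_le (by norm_num) (by nlinarith), Real.rpow_neg_one]
      nlinarith
    have h3 : Real.logb 2 ε₂ ≤ 0 := Real.logb_nonpos (by norm_num) hε₂.le hε₂1
    have h4 : 0 ≤ Real.logb 2 ((k : ℝ) + 1) := Real.logb_nonneg (by norm_num) (by linarith)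
    have h5 : (-3 : ℝ) ≤ M := by linarith [hM i]
    have : -3 ≤ M := by exact_mod_cast h5
    linarith
  obtain ⟨m, hm⟩ := Int.eq_ofNat_of_zero_le hM0
  have hm' : (M : ℝ) + 3 = m := by exact_mod_cast hm
  have hcode : ∀ F : Finset (X → (Fin m → Bool)), CQ.IsTwoUniversal F →
      ∃ S : CQ.SourceCode X (Fin m → Bool) B, S.enc ∈ F ∧ S.IsGood P φ ε := by
    intro F hF
    refine CQ.exists_good_code hP_nonneg hP_sum hφ hε₁ (div_pos hε₂ hk1) ?_ hH (fun i => ?_) hF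
    · rw [mul_div_cancel₀ _ hk1.ne']
      linarith
    · rw [Real.logb_div hε₂.ne' hk1.ne', ← hm']
      linarith [hM i]
  refine ⟨m, ?_, ?_, hcode⟩
  · rw [hm]
    simp [Real.logb_pow]
  · obtain ⟨S, -, hS⟩ := hcode _ CQ.isTwoUniversal_univ
    exact ⟨S, hS⟩
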